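/- Let $F_2$ be a degree $2$ graded super bundle over $M$: a real supermanifold with local homogeneous coordinates of weights $0,1,2$ (each even or odd, independently of the weight), whose coordinate changes preserve weight and parity and are polynomial in the coordinates of non-zero weight. The weight-$0$ coordinates are the local coordinates of the (super)manifold $M$, whose body is a Hausdorff, second countable smooth manifold. Let $\mathcal A^w(F_2)$ be the functions of weight $w$, so that $\mathcal A^0(F_2)=C^\infty(M)$, and let $\widetilde{a}\in\mathbb Z/2$ denote the parity of $a$. A symplectic nearly Lie 2-algebroid is such an $F_2$ together with a nondegenerate even Poisson bracket $\{\cdot,\cdot\}$ of weight $-2$ and an odd function $\Theta\in\mathcal A^3(F_2)$ (no condition is imposed on $\{\Theta,\Theta\}$). For parity-homogeneous $\sigma,\psi\in\mathcal A^1(F_2)$ and $f\in C^\infty(M)$ define the Courant–Dorfman pre-bracket and the anchor by $$[\![\sigma,\psi]\!]_\Theta=(-1)^{\widetilde\sigma}\{\{\Theta,\sigma\},\psi\}\in\mathcal A^1(F_2),\qquad \rho_\Theta(\sigma)f=(-1)^{\widetilde\sigma}\{\{\Theta,\sigma\},f\},$$ so that $\rho_\Theta(\sigma)$ is a vector field on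 $M$ of parity $\widetilde\sigma+1$; let $[\cdot,\cdot]$ be the supercommutator of vector fields on $M$. **Proposition.** For every symplectic nearly Lie 2-algebroid, all parity-homogeneous $\sigma,\psi\in\mathcal A^1(F_2)$ and all parity-homogeneous $f\in C^\infty(M)$, $$[\rho_\Theta(\sigma),\rho_\Theta(\psi)]f-\rho_\Theta([\![\sigma,\psi]\!]_\Theta)f=\tfrac12(-1)^{\widetilde f(\widetilde\sigma+\widetilde\psi)+\widetilde\psi}\{\{\{\{\Theta,\Theta\},f\},\sigma\},\psi\}.$$ In particular, the anchor and the pre-bracket are compatible, i.e. $[\rho_\Theta(\sigma),\rho_\Theta(\psi)]=\rho_\Theta([\![\sigma,\psi]\!]_\Theta)$ for all $\sigma,\psi$, if and only if $\{\{\Theta,\Theta\},f\}=0$ for all $f\in C^\infty(M)$. -/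

import Mathlib

open TopologicalSpace
open scoped Manifold ContDiff

universe u v

noncomputable section

namespace PreCourant

/-- The Koszul sign `(-1)^p` of a Grassmann parity `p`. -/
def superSign (p : ZMod 2) : ℝ := (-1) ^ p.val

theorem superSign_add (p q : ZMod 2) : superSign (p + q) = superSign p * superSign q := by
  have h : ∀ p q : ZMod 2, (p + q).val % 2 = (p.val + q.val) % 2 := by decide
  unfold superSign
  rw [← pow_add, neg_one_pow_eq_pow_mod_two, h, ← neg_one_pow_eq_pow_mod_two]

/-- The presheaf of (fibrewise polynomial) functions of a non-negatively graded supermanifold,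
seen over its body `M`: `A U` is the algebra `𝒜(F|_U)` spanned by the homogeneous functions on the
part of the supermanifold `F` over the open set `U ⊆ M`, and `comp U (w, p)` is the space of
functions of weight `w` and Grassmann parity `p`.  The homogeneity structure `h` of `F` is encoded
by the weights: `h_t` multiplies a function of weight `w` by `t ^ w`.  Each space of
bihomogeneous functions is a sheaf, the multiplication is supercommutative, and the
weights are non-negative. -/
structure GradedFunctionSheaf (M : Type u) [TopologicalSpace M] where
  A : Opens M → Type v
  [ring : ∀ U, Ring (A U)]
  [algebra : ∀ U, Algebra ℝ (A U)]
  /-- restriction of functions -/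
  res : ∀ {U V : Opens M}, V ≤ U → A U →ₐ[ℝ] A V
  res_self : ∀ (U : Opens M) (a : A U), res le_rfl a = a
  res_res : ∀ {U V W : Opens M} (hV : V ≤ U) (hW : W ≤ V) (a : A U),
    res hW (res hV a) = res (hW.trans hV) a
  /-- functions of weight `d.1` and parity `d.2` -/
  comp : ∀ U, ℤ × ZMod 2 → Submodule ℝ (A U)
  [gradedMonoid : ∀ U, SetLike.GradedMonoid (comp U)]
  isInternal : ∀ U, DirectSum.IsInternal (comp U)
  comp_neg : ∀ U (w : ℤ) (p : ZMod 2), w < 0 → comp U (w, p) = ⊥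
  supercomm : ∀ U (w w' : ℤ) (p q : ZMod 2) (a b : A U), a ∈ comp U (w, p) → b ∈ comp U (w', q) →
    a * b = superSign (p * q) • (b * a)
  res_mem : ∀ {U V : Opens M} (h : V ≤ U) (d : ℤ × ZMod 2) (a : A U),
    a ∈ comp U d → res h a ∈ comp V d
  /-- unique gluing of bihomogeneous functions -/
  glue : ∀ {ι : Type u} (U : ι → Opens M) (d : ℤ × ZMod 2) (a : ∀ i, A (U i)),
    (∀ i, a i ∈ comp (U i) d) →
    (∀ i j, res (inf_le_left : U i ⊓ U j ≤ U i) (a i) =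
      res (inf_le_right : U i ⊓ U j ≤ U j) (a j)) →
    ∃! b : A (⨆ i, U i), b ∈ comp (⨆ i, U i) d ∧ ∀ i, res (le_iSup U i) b = a i

attribute [instance] GradedFunctionSheaf.ring GradedFunctionSheaf.algebra
  GradedFunctionSheaf.gradedMonoid

/-- Smooth real functions on an open subset of the body. -/
abbrev SmoothFun (n : ℕ) {M : Type u} [TopologicalSpace M]
    [ChartedSpace (EuclideanSpace ℝ (Fin n)) M] (U : Opens M) : Type u :=
  C^∞⟮𝓡 n, U; 𝓘(ℝ, ℝ), ℝ⟯

/-- The `a`-th coordinate function of a chart of the body, as a smooth function on its domain. -/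
def chartCoord {n : ℕ} {M : Type u} [TopologicalSpace M]
    [ChartedSpace (EuclideanSpace ℝ (Fin n)) M]
    (φ : OpenPartialHomeomorph M (EuclideanSpace ℝ (Fin n)))
    (hφ : φ ∈ IsManifold.maximalAtlas (𝓡 n) ∞ M) (a : Fin n) :
    SmoothFun n (⟨φ.source, φ.open_source⟩ : Opens M) :=
  ⟨fun m => φ m.1 a, by
    have h1 : ContMDiffOn (𝓡 n) (𝓡 n) ∞ φ φ.source := contMDiffOn_of_mem_maximalAtlas hφ
    have h2 : ContMDiff (𝓡 n) (𝓡 n) ∞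
        (fun m : (⟨φ.source, φ.open_source⟩ : Opens M) => φ m.1) :=
      h1.comp_contMDiff contMDiff_subtype_val (fun m => m.2)
    have h3 : ContMDiff (𝓡 n) 𝓘(ℝ, ℝ) ∞ (fun y : EuclideanSpace ℝ (Fin n) => y a) :=
      ContDiff.contMDiff (EuclideanSpace.proj (𝕜 := ℝ) a).contDiff
    exact h3.comp h2⟩

/-- Homogeneous local coordinates `(x^a, y^i, θ^j)` of a graded supermanifold, over the domain of a
chart of the body: `x^a` even of weight `0`, `y^i` even of weight `wtEven i`, and
`θ^j` odd of weight `wtOdd j`.  The homomorphisms `pull W` substitute the even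
coordinates `x^a` into smooth functions, and every function over an open subset `W` of the domain
is uniquely a finite sum `∑ f_{α,S}(x) y^α θ^S` with smooth coefficients. -/
structure HomogeneousChart {n : ℕ} {M : Type u} [TopologicalSpace M]
    [ChartedSpace (EuclideanSpace ℝ (Fin n)) M]
    (F : GradedFunctionSheaf.{u, v} M) {k l : ℕ} (wtEven : Fin k → ℤ) (wtOdd : Fin l → ℤ) where
  base : OpenPartialHomeomorph M (EuclideanSpace ℝ (Fin n))
  base_mem : base ∈ IsManifold.maximalAtlas (𝓡 n) ∞ M
  pull : ∀ W : Opens M, W ≤ ⟨base.source, base.open_source⟩ → (SmoothFun n W →ₐ[ℝ] F.A W)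
  pull_mem : ∀ W hW f, pull W hW f ∈ F.comp W (0, 0)
  res_pull : ∀ (W W' : Opens M) (hW : W ≤ ⟨base.source, base.open_source⟩) (h : W' ≤ W)
    (f : SmoothFun n W), F.res h (pull W hW f) =
      pull W' (h.trans hW) (ContMDiffMap.restrictRingHom (𝓡 n) 𝓘(ℝ, ℝ) ℝ h f)
  y : Fin k → F.A ⟨base.source, base.open_source⟩
  y_mem : ∀ i, y i ∈ F.comp _ (wtEven i, 0)
  θ : Fin l → F.A ⟨base.source, base.open_source⟩
  θ_mem : ∀ j, θ j ∈ F.comp _ (wtOdd j, 1)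
  expansion : ∀ (W : Opens M) (hW : W ≤ ⟨base.source, base.open_source⟩),
    Function.Bijective fun c : ((Fin k → ℕ) × Finset (Fin l)) →₀ SmoothFun n W =>
      c.sum fun m f => pull W hW f * F.res hW
        ((List.ofFn fun i => y i ^ m.1 i).prod *
          (List.ofFn fun j => if j ∈ m.2 then θ j else 1).prod)

namespace HomogeneousChart

variable {n : ℕ} {M : Type u} [TopologicalSpace M] [ChartedSpace (EuclideanSpace ℝ (Fin n)) M]
  {F : GradedFunctionSheaf.{u, v} M} {k l : ℕ} {wtEven : Fin k → ℤ} {wtOdd : Fin l → ℤ}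

/-- The domain of the coordinates. -/
def dom (c : HomogeneousChart (n := n) F wtEven wtOdd) : Opens M :=
  ⟨c.base.source, c.base.open_source⟩

/-- All coordinates `(x^a, y^i, θ^j)` as one family. -/
def coord (c : HomogeneousChart (n := n) F wtEven wtOdd) : Fin n ⊕ Fin k ⊕ Fin l → F.A c.dom
  | .inl a => c.pull c.dom le_rfl (chartCoord c.base c.base_mem a)
  | .inr (.inl i) => c.y i
  | .inr (.inr j) => c.θ j

end HomogeneousChart

/-- A degree `2` graded super bundle with body `M`: near every point there are
homogeneous coordinates, whose weights are `0`, `1` and `2`; the even coordinates of weight `0` are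
those of the body.  Weights and parities are otherwise independent. -/
structure GradedSuperBundle2 (n : ℕ) (M : Type u) [TopologicalSpace M]
    [ChartedSpace (EuclideanSpace ℝ (Fin n)) M] extends GradedFunctionSheaf.{u, v} M where
  /-- number of even coordinates of non-zero weight -/
  k : ℕ
  /-- number of odd coordinates -/
  l : ℕ
  wtEven : Fin k → ℤ
  wtOdd : Fin l → ℤ
  wtEven_mem : ∀ i, wtEven i ∈ ({1, 2} : Set ℤ)
  wtOdd_mem : ∀ j, wtOdd j ∈ ({0, 1, 2} : Set ℤ)
  exists_chart : ∀ m : M, ∃ c : HomogeneousChart (n := n) toGradedFunctionSheaf wtEven wtOdd,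
    m ∈ c.dom

/-- An even Poisson bracket of weight `-2` on a degree `2` graded super bundle. -/
structure PoissonBracket {n : ℕ} {M : Type u} [TopologicalSpace M]
    [ChartedSpace (EuclideanSpace ℝ (Fin n)) M] (F : GradedSuperBundle2.{u, v} n M) where
  br : ∀ U, F.A U →ₗ[ℝ] F.A U →ₗ[ℝ] F.A U
  res_br : ∀ {U V : Opens M} (h : V ≤ U) (a b : F.A U),
    F.res h (br U a b) = br V (F.res h a) (F.res h b)
  br_mem : ∀ U (w w' : ℤ) (p q : ZMod 2) (a b : F.A U),
    a ∈ F.comp U (w, p) → b ∈ F.comp U (w', q) → br U a b ∈ F.comp U (w + w' - 2, p + q)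
  skew : ∀ U (w w' : ℤ) (p q : ZMod 2) (a b : F.A U),
    a ∈ F.comp U (w, p) → b ∈ F.comp U (w', q) →
      br U a b = -(superSign (p * q) • br U b a)
  leibniz : ∀ U (w w' : ℤ) (p q : ZMod 2) (a b c : F.A U),
    a ∈ F.comp U (w, p) → b ∈ F.comp U (w', q) →
      br U a (b * c) = br U a b * c + superSign (p * q) • (b * br U a c)
  jacobi : ∀ U (w w' : ℤ) (p q : ZMod 2) (a b c : F.A U),
    a ∈ F.comp U (w, p) → b ∈ F.comp U (w', q) →
      br U a (br U b c) = br U (br U a b) c + superSign (p * q) • br U b (br U a c)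

/-- A Poisson bracket is nondegenerate if in homogeneous coordinates the matrix of the
brackets of the coordinates is invertible. -/
def PoissonBracket.Nondegenerate {n : ℕ} {M : Type u} [TopologicalSpace M]
    [ChartedSpace (EuclideanSpace ℝ (Fin n)) M] {F : GradedSuperBundle2.{u, v} n M}
    (P : PoissonBracket F) : Prop :=
  ∀ c : HomogeneousChart (n := n) F.toGradedFunctionSheaf F.wtEven F.wtOdd,
    IsUnit (Matrix.of fun s t => P.br c.dom (c.coord s) (c.coord t))

/-- A symplectic nearly Lie 2-algebroid: a degree `2` graded super bundle, a nondegenerate Poisson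
bracket of weight `-2`, and an odd function `Θ` of weight `3`. -/
structure SymplecticNearlyLie2Algebroid (n : ℕ) (M : Type u) [TopologicalSpace M]
    [ChartedSpace (EuclideanSpace ℝ (Fin n)) M] extends GradedSuperBundle2.{u, v} n M where
  poisson : PoissonBracket toGradedSuperBundle2
  nondegenerate : poisson.Nondegenerate
  Θ : A ⊤
  Θ_mem : Θ ∈ comp ⊤ (3, 1)

namespace SymplecticNearlyLie2Algebroid

variable {n : ℕ} {M : Type u} [TopologicalSpace M] [ChartedSpace (EuclideanSpace ℝ (Fin n)) M]
  (L : SymplecticNearlyLie2Algebroid.{u, v} n M)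

/-- The Poisson bracket `{a, b}` of global functions. -/
def pb (a b : L.A ⊤) : L.A ⊤ := L.poisson.br ⊤ a b

/-- `C^∞(M)`: the (super)algebra of functions of weight zero. -/
def baseFun : Subalgebra ℝ (L.A ⊤) where
  carrier := (⨆ r : ZMod 2, L.comp ⊤ (0, r) : Submodule ℝ (L.A ⊤))
  mul_mem' := by
    intro a b ha hb
    simp only [SetLike.mem_coe] at ha hb ⊢
    induction ha using Submodule.iSup_induction' with
    | mem r x hx =>
      induction hb using Submodule.iSup_induction' with
      | mem s z hz =>
        exact Submodule.mem_iSup_of_mem (r + s) (SetLike.mul_mem_graded hx hz)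
      | zero => simp
      | add z z' _ _ h h' => rw [mul_add]; exact add_mem h h'
    | zero => simp
    | add x x' _ _ h h' => rw [add_mul]; exact add_mem h h'
  add_mem' := fun ha hb => add_mem (S := Submodule ℝ (L.A ⊤)) ha hb
  algebraMap_mem' := by
    intro c
    rw [Algebra.algebraMap_eq_smul_one]
    exact Submodule.smul_mem _ _
      (Submodule.mem_iSup_of_mem 0 (SetLike.one_mem_graded (L.comp ⊤)))

theorem mem_baseFun {a : L.A ⊤} :
    a ∈ L.baseFun ↔ a ∈ (⨆ r : ZMod 2, L.comp ⊤ (0, r) : Submodule ℝ (L.A ⊤)) := Iff.rfl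

/-- Base functions of parity `r`. -/
def IsHomogeneous (r : ZMod 2) (f : L.baseFun) : Prop := (f : L.A ⊤) ∈ L.comp ⊤ (0, r)

/-- Sections: functions of weight one, of parity `p`. -/
abbrev Sec (p : ZMod 2) : Submodule ℝ (L.A ⊤) := L.comp ⊤ (1, p)

/-- `Vect(M)`: vector fields of parity `p` on the (super)manifold `M`, i.e. the
superderivations of parity `p` of `C^∞(M)`. -/
def VectM (p : ZMod 2) : Submodule ℝ (Module.End ℝ L.baseFun) where
  carrier := {X | (∀ r f, L.IsHomogeneous r f → L.IsHomogeneous (p + r) (X f)) ∧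
    ∀ r f g, L.IsHomogeneous r f → X (f * g) = X f * g + superSign (p * r) • (f * X g)}
  zero_mem' := ⟨fun _ _ _ => zero_mem (L.comp ⊤ _), fun _ _ _ _ => by simp⟩
  add_mem' := by
    rintro X Y ⟨h1, h2⟩ ⟨h3, h4⟩
    refine ⟨fun r f hf => add_mem (h1 r f hf) (h3 r f hf), fun r f g hf => ?_⟩
    simp only [LinearMap.add_apply, h2 r f g hf, h4 r f g hf, add_mul, mul_add, smul_add]
    abel
  smul_mem' := by
    rintro c X ⟨h1, h2⟩
    refine ⟨fun r f hf => Submodule.smul_mem _ c (h1 r f hf), fun r f g hf => ?_⟩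
    simp only [LinearMap.smul_apply, h2 r f g hf, smul_add, smul_mul_assoc, mul_smul_comm,
      smul_comm c]

/-- The Lie bracket of vector fields: the supercommutator `XY - (-1)^{pq} YX`. -/
def lieBracket {p q : ZMod 2} (X : L.VectM p) (Y : L.VectM q) : L.VectM (p + q) :=
  ⟨X.1 * Y.1 - superSign (p * q) • (Y.1 * X.1), by
    obtain ⟨X, hX, hX'⟩ := X
    obtain ⟨Y, hY, hY'⟩ := Y
    refine ⟨fun r f hf => ?_, fun r f g hf => ?_⟩
    · have h1 := hX _ _ (hY _ _ hf)
      have h2 := hY _ _ (hX _ _ hf)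
      have e1 : p + (q + r) = p + q + r := by ring
      have e2 : q + (p + r) = p + q + r := by ring
      rw [e1] at h1
      rw [e2] at h2
      exact sub_mem h1 (Submodule.smul_mem _ _ h2)
    · have e : ∀ a b c : ZMod 2, superSign (a * (b + c)) = superSign (a * b) * superSign (a * c) :=
        fun a b c => by rw [mul_add, superSign_add]
      have e' : superSign ((p + q) * r) = superSign (p * r) * superSign (q * r) := by
        rw [add_mul, superSign_add]
      have e0 : superSign (q * p) = superSign (p * q) := by rw [mul_comm]
      have e1 : superSign (p * q) * superSign (p * q) = 1 := by
        rw [← superSign_add, CharTwo.add_self_eq_zero]; simp [superSign]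
      simp only [LinearMap.sub_apply, LinearMap.smul_apply, Module.End.mul_apply,
        hY' _ _ _ hf, hX' _ _ _ hf, map_add, map_smul, hX' _ _ _ (hY _ _ hf),
        hY' _ _ _ (hX _ _ hf), e, e', e0, sub_mul, mul_sub, smul_sub, smul_add, smul_mul_assoc,
        mul_smul_comm, smul_smul]
      simp only [← mul_assoc, e1, one_mul]
      module⟩

/-- The Courant-Dorfman pre-bracket `⟦σ, ψ⟧ = (-1)^σ {{Θ, σ}, ψ}` of sections. -/
def dorfman {p q : ZMod 2} (σ : L.Sec p) (ψ : L.Sec q) : L.Sec (p + q + 1) :=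
  ⟨superSign p • L.pb (L.pb L.Θ σ) ψ, by
    have h := L.poisson.br_mem ⊤ _ _ _ _ _ _ (L.poisson.br_mem ⊤ _ _ _ _ _ _ L.Θ_mem σ.2) ψ.2
    have e : 1 + p + q = p + q + 1 := by ring
    rw [e] at h
    exact Submodule.smul_mem _ _ h⟩

theorem pb_pb_mem {p r : ZMod 2} (σ : L.Sec p) {f : L.A ⊤} (hf : f ∈ L.comp ⊤ (0, r)) :
    L.pb (L.pb L.Θ σ) f ∈ L.comp ⊤ (0, p + 1 + r) := by
  have h := L.poisson.br_mem ⊤ _ _ _ _ _ _ (L.poisson.br_mem ⊤ _ _ _ _ _ _ L.Θ_mem σ.2) hf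
  have e : 1 + p + r = p + 1 + r := by ring
  rw [e] at h
  exact h

theorem pb_pb_mem_baseFun {p : ZMod 2} (σ : L.Sec p) {f : L.A ⊤} (hf : f ∈ L.baseFun) :
    L.pb (L.pb L.Θ σ) f ∈ L.baseFun := by
  rw [mem_baseFun] at hf ⊢
  induction hf using Submodule.iSup_induction' with
  | mem r x hx => exact Submodule.mem_iSup_of_mem _ (L.pb_pb_mem σ hx)
  | zero => simp [pb]
  | add x x' _ _ h h' =>
    have : L.pb (L.pb L.Θ σ) (x + x') = L.pb (L.pb L.Θ σ) x + L.pb (L.pb L.Θ σ) x' := by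
      simp [pb]
    rw [this]
    exact add_mem h h'

/-- The anchor map `ρ(σ) f = (-1)^σ {{Θ, σ}, f}`. -/
def anchor {p : ZMod 2} (σ : L.Sec p) : L.VectM (p + 1) :=
  ⟨{ toFun := fun f => superSign p • ⟨L.pb (L.pb L.Θ σ) f, L.pb_pb_mem_baseFun σ f.2⟩
     map_add' := fun f g => by
      apply Subtype.ext
      simp [pb]
     map_smul' := fun c f => by
      apply Subtype.ext
      simp [pb, smul_comm c] },
   by
    refine ⟨fun r f hf => Submodule.smul_mem _ _ (L.pb_pb_mem σ hf), fun r f g hf => ?_⟩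
    apply Subtype.ext
    have h := L.poisson.leibniz ⊤ _ _ _ _ _ _ (g : L.A ⊤)
      (L.poisson.br_mem ⊤ _ _ _ _ _ _ L.Θ_mem σ.2) hf
    rw [add_comm 1 p] at h
    simp [pb, h, smul_smul, mul_comm]⟩

/-- The anchor and the Courant-Dorfman pre-bracket are compatible:
`[ρ(σ), ρ(ψ)] = ρ(⟦σ, ψ⟧)` as vector fields, for all sections. -/
def AnchorCompatible : Prop :=
  ∀ (p q : ZMod 2) (σ : L.Sec p) (ψ : L.Sec q),
    (L.lieBracket (L.anchor σ) (L.anchor ψ) : Module.End ℝ L.baseFun) =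
      L.anchor (L.dorfman σ ψ)

end SymplecticNearlyLie2Algebroid

end PreCourant

end

/-!
Write `R = {Θ, Θ}`. By the Jacobi identity the commutator of two anchors is the action of
`{{Θ, σ}, {Θ, ψ}}` on base functions, and differs from the anchor of the pre-bracket by the action
of `{{Θ, {Θ, σ}}, ψ} = 1/2 {{R, σ}, ψ}`. Sections and base functions Poisson commute, since their
bracket would have weight `-1`; hence the argument `f` can be moved past `ψ` and `σ`, at the cost of
a Koszul sign, and the defect becomes a multiple of `{{{R, f}, σ}, ψ}`
(`coe_lieBracket_anchor_sub_anchor_dorfman`).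

It remains to recover `G = {R, f}`, a function of weight `2`, from the vanishing of all
`{{G, σ}, ψ}`. Nondegeneracy enters through the Euler vector field. On the domain of homogeneous
coordinates `z_s` of weight `w_s`, let `N` be the inverse of the matrix of brackets `{z_s, z_t}`,
with entries of weight `2 - w_s - w_t`. The map `a ↦ ∑ w_t {a, z_s} N_{st} z_t` is a derivation
which kills the functions of weight `0` and multiplies `z_t` by `w_t`, so it multiplies every
function by its weight (`euler_of_mem`). As there are no functions of negative weight, only
brackets with coordinates of weight at most `1` contribute; a function of non-zero weight that
Poisson commutes with these coordinates therefore vanishes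
(`Nondegenerate.eq_zero_of_br_coord_eq_zero`).

Bump functions extend local functions to global ones, so hypotheses on global sections may be
tested on coordinates. Applied to `{G, σ}`, of weight `1`, this gives `{G, σ} = 0` for all sections
`σ`. Then `{G, g} σ = {G, g σ} = 0` for base functions `g`, up to a multiple of `{G, σ} = 0`. Where
there is a coordinate of weight `1` this forces `{G, g} = 0`, hence `G = 0`; where there is none,
there are no functions of weight `3`, so `Θ = 0`.
-/

namespace PreCourant

/-! ### The compatibility defect of the anchor and the pre-bracket -/

theorem superSign_mul_self (p : ZMod 2) : superSign p * superSign p = 1 := by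
  rw [← superSign_add, CharTwo.add_self_eq_zero]
  simp [superSign]

@[simp]
theorem superSign_zero : superSign 0 = 1 := by
  simp [superSign]

@[simp]
theorem superSign_one : superSign 1 = -1 := by
  simp [superSign, ZMod.val_one]

/-- A Koszul sign is an involution, so an exponent occurring an even number of times drops out. -/
theorem superSign_smul_smul {V : Type*} [AddCommGroup V] [Module ℝ V] (p : ZMod 2) (x : V) :
    superSign p • superSign p • x = x := by
  rw [smul_smul, superSign_mul_self, one_smul]

namespace PoissonBracket

variable {n : ℕ} {M : Type u} [TopologicalSpace M] [ChartedSpace (EuclideanSpace ℝ (Fin n)) M]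
  {F : GradedSuperBundle2.{u, v} n M} (P : PoissonBracket F) {U : Opens M}

/-- Functions whose weights add up to less than `2` Poisson commute: their bracket would have
negative weight. -/
theorem br_eq_zero_of_weight_lt {w w' : ℤ} {p q : ZMod 2} {a b : F.A U}
    (ha : a ∈ F.comp U (w, p)) (hb : b ∈ F.comp U (w', q)) (h : w + w' < 2) : P.br U a b = 0 := by
  have := P.br_mem U w w' p q a b ha hb
  rwa [F.comp_neg U _ _ (by omega), Submodule.mem_bot] at this

/-- If `b` and `c` Poisson commute, then so do the right adjoint actions `{·, b}` and `{·, c}`, up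
to the Koszul sign. -/
theorem br_br_comm_of_br_eq_zero {w w₁ w₂ : ℤ} {p q r : ZMod 2} {a b c : F.A U}
    (ha : a ∈ F.comp U (w, p)) (hb : b ∈ F.comp U (w₁, q)) (hc : c ∈ F.comp U (w₂, r))
    (h : P.br U b c = 0) :
    P.br U (P.br U a b) c = superSign (q * r) • P.br U (P.br U a c) b := by
  have hJ := P.jacobi U _ _ _ _ a b c ha hb
  rw [h, map_zero, P.skew U _ _ _ _ b (P.br U a c) hb (P.br_mem U _ _ _ _ _ _ ha hc), smul_neg,
    smul_smul, ← superSign_add, show p * q + q * (p + r) = q * r + (p * q + p * q) by ring,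
    CharTwo.add_self_eq_zero, add_zero] at hJ
  exact (sub_eq_zero.1 (by rw [sub_eq_add_neg]; exact hJ.symm))

/-- For odd `a`, applying `{a, ·}` twice is half of the action of `{a, a}`. -/
theorem br_br_self_of_odd {w : ℤ} {a : F.A U} (ha : a ∈ F.comp U (w, 1)) (b : F.A U) :
    P.br U a (P.br U a b) = (1 / 2 : ℝ) • P.br U (P.br U a a) b := by
  have hJ := P.jacobi U _ _ _ _ a a b ha ha
  rw [mul_one, superSign_one, neg_one_smul] at hJ
  have h2 : P.br U (P.br U a a) b = (2 : ℝ) • P.br U a (P.br U a b) := by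
    rw [two_smul]
    nth_rewrite 1 [hJ]
    abel
  rw [h2, smul_smul]
  norm_num

/-- The Leibniz rule in the first argument of the bracket. -/
theorem br_mul_left {w w' w'' : ℤ} {p q r : ZMod 2} {a b c : F.A U}
    (ha : a ∈ F.comp U (w, p)) (hb : b ∈ F.comp U (w', q)) (hc : c ∈ F.comp U (w'', r)) :
    P.br U (a * b) c = a * P.br U b c + superSign (q * r) • (P.br U a c * b) := by
  have hab : a * b ∈ F.comp U (w + w', p + q) := SetLike.mul_mem_graded ha hb
  rw [P.skew U _ _ _ _ _ _ hab hc, P.leibniz U _ _ _ _ c a b hc ha,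
    P.skew U _ _ _ _ b c hb hc, P.skew U _ _ _ _ a c ha hc, mul_comm r p, add_mul, superSign_add]
  simp only [mul_neg, neg_mul, mul_smul_comm, smul_mul_assoc, smul_neg, smul_add, smul_smul]
  rw [mul_right_comm, superSign_mul_self, one_mul, mul_comm (superSign (p * r)), neg_add, add_comm]

end PoissonBracket

namespace SymplecticNearlyLie2Algebroid

variable {n : ℕ} {M : Type u} [TopologicalSpace M] [ChartedSpace (EuclideanSpace ℝ (Fin n)) M]
  (L : SymplecticNearlyLie2Algebroid.{u, v} n M)

theorem pb_Θ_Θ_mem : L.pb L.Θ L.Θ ∈ L.comp ⊤ (4, 0) :=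
  L.poisson.br_mem ⊤ 3 3 1 1 _ _ L.Θ_mem L.Θ_mem

theorem pb_pb_Θ_Θ_mem {r : ZMod 2} {f : L.A ⊤} (hf : f ∈ L.comp ⊤ (0, r)) :
    L.pb (L.pb L.Θ L.Θ) f ∈ L.comp ⊤ (2, r) := by
  have := L.poisson.br_mem ⊤ _ _ _ _ _ _ L.pb_Θ_Θ_mem hf
  rwa [zero_add] at this

/-- The action of `{Θ, Θ}` on a function may be moved past two sections, since a section and a base
function Poisson commute. -/
theorem pb_section_section_fun {p q r : ZMod 2} (σ : L.Sec p) (ψ : L.Sec q) {f : L.A ⊤}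
    (hf : f ∈ L.comp ⊤ (0, r)) :
    L.pb (L.pb (L.pb (L.pb L.Θ L.Θ) σ) ψ) f =
      superSign (r * (p + q)) • L.pb (L.pb (L.pb (L.pb L.Θ L.Θ) f) σ) ψ := by
  have hR := L.pb_Θ_Θ_mem
  have hRσ := L.poisson.br_mem ⊤ _ _ _ _ _ _ hR σ.2
  have h1 := L.poisson.br_br_comm_of_br_eq_zero hRσ ψ.2 hf
    (L.poisson.br_eq_zero_of_weight_lt ψ.2 hf (by norm_num))
  have h2 := L.poisson.br_br_comm_of_br_eq_zero hR σ.2 hf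
    (L.poisson.br_eq_zero_of_weight_lt σ.2 hf (by norm_num))
  unfold pb at *
  rw [h1, h2, map_smul, LinearMap.smul_apply, smul_smul, ← superSign_add]
  ring_nf

theorem coe_anchor_apply {p : ZMod 2} (σ : L.Sec p) (f : L.baseFun) :
    (((L.anchor σ : Module.End ℝ L.baseFun) f : L.baseFun) : L.A ⊤) =
      superSign p • L.pb (L.pb L.Θ σ) f := rfl

theorem coe_lieBracket_apply {p q : ZMod 2} (X : L.VectM p) (Y : L.VectM q) (f : L.baseFun) :
    (((L.lieBracket X Y : Module.End ℝ L.baseFun) f : L.baseFun) : L.A ⊤) =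
      (X.1 (Y.1 f) : L.A ⊤) - superSign (p * q) • (Y.1 (X.1 f) : L.A ⊤) := rfl

/-- The commutator of two anchors is the Hamiltonian action of `{{Θ, σ}, {Θ, ψ}}`. -/
theorem coe_lieBracket_anchor_apply {p q : ZMod 2} (σ : L.Sec p) (ψ : L.Sec q) (f : L.baseFun) :
    (((L.lieBracket (L.anchor σ) (L.anchor ψ) : Module.End ℝ L.baseFun) f : L.baseFun) : L.A ⊤) =
      superSign (p + q) • L.pb (L.pb (L.pb L.Θ σ) (L.pb L.Θ ψ)) f := by
  have hσ := L.poisson.br_mem ⊤ _ _ _ _ _ _ L.Θ_mem σ.2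
  have hψ := L.poisson.br_mem ⊤ _ _ _ _ _ _ L.Θ_mem ψ.2
  have hJ := L.poisson.jacobi ⊤ _ _ _ _ _ _ (f : L.A ⊤) hσ hψ
  rw [coe_lieBracket_apply, coe_anchor_apply, coe_anchor_apply, coe_anchor_apply,
    coe_anchor_apply, superSign_add p q]
  unfold pb at *
  simp only [map_smul]
  rw [hJ, add_comm 1 p, add_comm 1 q]
  module

/-- The defect of the compatibility of the anchor with the pre-bracket. -/
theorem coe_lieBracket_anchor_sub_anchor_dorfman {p q r : ZMod 2} (σ : L.Sec p) (ψ : L.Sec q)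
    (f : L.baseFun) (hf : L.IsHomogeneous r f) :
    (((L.lieBracket (L.anchor σ) (L.anchor ψ) : Module.End ℝ L.baseFun) f -
        (L.anchor (L.dorfman σ ψ) : Module.End ℝ L.baseFun) f : L.baseFun) : L.A ⊤) =
      ((1 / 2 : ℝ) * superSign (r * (p + q) + q)) •
        L.pb (L.pb (L.pb (L.pb L.Θ L.Θ) f) σ) ψ := by
  have hσ := L.poisson.br_mem ⊤ _ _ _ _ _ _ L.Θ_mem σ.2
  have hJ := L.poisson.jacobi ⊤ _ _ _ _ _ _ (ψ : L.A ⊤) L.Θ_mem hσ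
  rw [L.poisson.br_br_self_of_odd L.Θ_mem] at hJ
  have hD : ((L.dorfman σ ψ : L.Sec (p + q + 1)) : L.A ⊤) =
    superSign p • L.pb (L.pb L.Θ σ) ψ := rfl
  have hsw := L.pb_section_section_fun σ ψ hf
  rw [AddSubgroupClass.coe_sub, coe_lieBracket_anchor_apply, coe_anchor_apply, hD]
  unfold pb at *
  simp only [map_smul, hJ, map_add, LinearMap.add_apply, LinearMap.smul_apply, hsw, superSign_add,
    one_mul, superSign_one, smul_add, smul_smul]
  have hp := superSign_mul_self p
  match_scalars
  · linear_combination (-superSign p * superSign q) * hp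
  · linear_combination (1 / 2 * superSign q * superSign (r * (p + q))) * hp

end SymplecticNearlyLie2Algebroid

/-! ### The Euler vector field of a nondegenerate bracket -/

noncomputable instance {M : Type u} [TopologicalSpace M] (F : GradedFunctionSheaf.{u, v} M)
    (U : Opens M) :
    GradedRing (F.comp U) :=
  { F.gradedMonoid U, (F.isInternal U).chooseDecomposition (F.comp U) with }

namespace HomogeneousChart

variable {n : ℕ} {M : Type u} [TopologicalSpace M] [ChartedSpace (EuclideanSpace ℝ (Fin n)) M]
  {F : GradedFunctionSheaf.{u, v} M} {k l : ℕ} {wtEven : Fin k → ℤ} {wtOdd : Fin l → ℤ}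

/-- The weight of a coordinate. -/
def wt (_ : HomogeneousChart (n := n) F wtEven wtOdd) : Fin n ⊕ Fin k ⊕ Fin l → ℤ
  | .inl _ => 0
  | .inr (.inl i) => wtEven i
  | .inr (.inr j) => wtOdd j

/-- The Grassmann parity of a coordinate. -/
def par (_ : HomogeneousChart (n := n) F wtEven wtOdd) : Fin n ⊕ Fin k ⊕ Fin l → ZMod 2
  | .inl _ => 0
  | .inr (.inl _) => 0
  | .inr (.inr _) => 1

theorem coord_mem (c : HomogeneousChart (n := n) F wtEven wtOdd) (s : Fin n ⊕ Fin k ⊕ Fin l) :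
    c.coord s ∈ F.comp c.dom (c.wt s, c.par s) := by
  rcases s with a | i | j
  · exact c.pull_mem _ _ _
  · exact c.y_mem i
  · exact c.θ_mem j

/-- The functions on the domain of the coordinates are spanned by products of functions of the even
coordinates of weight `0` and of the remaining coordinates. -/
theorem mem_span_of_submonoid (c : HomogeneousChart (n := n) F wtEven wtOdd)
    (S : Submonoid (F.A c.dom)) (hpull : ∀ f, c.pull c.dom le_rfl f ∈ S)
    (hcoord : ∀ s, c.coord (.inr s) ∈ S) (b : F.A c.dom) :
    b ∈ Submodule.span ℝ (S : Set (F.A c.dom)) := by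
  obtain ⟨e, rfl⟩ := (c.expansion c.dom le_rfl).2 b
  refine Submodule.sum_mem _ fun m _ => Submodule.subset_span ?_
  refine S.mul_mem (hpull (e m)) ?_
  refine Set.mem_of_eq_of_mem (F.res_self c.dom _) (S.mul_mem ?_ ?_)
  · refine S.list_prod_mem fun x hx => ?_
    obtain ⟨i, rfl⟩ := List.mem_ofFn.1 hx
    exact S.pow_mem (hcoord (.inl i)) _
  · refine S.list_prod_mem fun x hx => ?_
    obtain ⟨j, rfl⟩ := List.mem_ofFn.1 hx
    by_cases h : j ∈ m.2
    · exact Set.mem_of_eq_of_mem (if_pos h) (hcoord (.inr j))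
    · exact Set.mem_of_eq_of_mem (if_neg h) S.one_mem

end HomogeneousChart

namespace PoissonBracket

variable {n : ℕ} {M : Type u} [TopologicalSpace M] [ChartedSpace (EuclideanSpace ℝ (Fin n)) M]
  {F : GradedSuperBundle2.{u, v} n M} (P : PoissonBracket F)
  (c : HomogeneousChart (n := n) F.toGradedFunctionSheaf F.wtEven F.wtOdd)

theorem wt_nonneg (s : Fin n ⊕ Fin F.k ⊕ Fin F.l) : 0 ≤ c.wt s := by
  rcases s with a | i | j
  · exact le_rfl
  · have := F.wtEven_mem i
    simp only [Set.mem_insert_iff, Set.mem_singleton_iff] at this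
    simp only [HomogeneousChart.wt]
    omega
  · have := F.wtOdd_mem j
    simp only [Set.mem_insert_iff, Set.mem_singleton_iff] at this
    simp only [HomogeneousChart.wt]
    omega

/-- The inverse of the matrix of brackets of the coordinates may be chosen with homogeneous
entries. -/
theorem Nondegenerate.exists_homogeneous_inverse {P : PoissonBracket F} (hP : P.Nondegenerate) :
    ∃ N : Fin n ⊕ Fin F.k ⊕ Fin F.l → Fin n ⊕ Fin F.k ⊕ Fin F.l → F.A c.dom,
      (∀ s t, N s t ∈ F.comp c.dom (2 - c.wt s - c.wt t, c.par s + c.par t)) ∧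
      ∀ s u, ∑ t, P.br c.dom (c.coord s) (c.coord t) * N t u = if s = u then 1 else 0 := by
  obtain ⟨N, hN⟩ := (hP c).exists_right_inv
  refine ⟨fun s t => (DirectSum.decompose (F.comp c.dom) (N s t)
    (2 - c.wt s - c.wt t, c.par s + c.par t) : F.A c.dom), fun s t => SetLike.coe_mem _,
    fun s u => ?_⟩
  have hsu := congrFun (congrFun hN s) u
  rw [Matrix.mul_apply, Matrix.one_apply] at hsu
  -- both sides are the component of the degree of `c.coord s` minus that of `c.coord u`
  have hproj := congrArg (fun a => (DirectSum.decompose (F.comp c.dom) a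
    (c.wt s - c.wt u, c.par s + c.par u) : F.A c.dom)) hsu
  simp only [Matrix.of_apply] at hproj
  rw [DirectSum.decompose_sum, DFinsupp.finsetSum_apply, AddSubmonoidClass.coe_finsetSum]
    at hproj
  have hδ : (DirectSum.decompose (F.comp c.dom) (if s = u then (1 : F.A c.dom) else 0)
      (c.wt s - c.wt u, c.par s + c.par u) : F.A c.dom) = if s = u then 1 else 0 := by
    split_ifs with h
    · subst h
      rw [sub_self, CharTwo.add_self_eq_zero]
      exact DirectSum.decompose_of_mem_same _ (SetLike.one_mem_graded (F.comp c.dom))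
    · simp
  rw [hδ] at hproj
  rw [← hproj]
  refine Finset.sum_congr rfl fun t _ => ?_
  have hB := P.br_mem _ _ _ _ _ _ _ (c.coord_mem s) (c.coord_mem t)
  have hd : ((c.wt s - c.wt u, c.par s + c.par u) : ℤ × ZMod 2) =
      (c.wt s + c.wt t - 2, c.par s + c.par t) + (2 - c.wt t - c.wt u, c.par t + c.par u) := by
    ext
    · simp only [Prod.mk_add_mk]
      ring
    · simp only [Prod.mk_add_mk]
      linear_combination -CharTwo.add_self_eq_zero (c.par t)
  rw [hd, DirectSum.coe_decompose_mul_add_of_left_mem _ hB]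

/-- The Euler vector field `a ↦ ∑ w_t {a, z_s} N_{st} z_t` built from the inverse `N` of the matrix
of brackets of the coordinates `z`, where `w_t` is the weight of `z_t`. -/
noncomputable def euler (N : Fin n ⊕ Fin F.k ⊕ Fin F.l → Fin n ⊕ Fin F.k ⊕ Fin F.l → F.A c.dom) :
    F.A c.dom →ₗ[ℝ] F.A c.dom :=
  ∑ s, ∑ t, (c.wt t : ℝ) •
    (LinearMap.mulRight ℝ (N s t * c.coord t) ∘ₗ (P.br c.dom).flip (c.coord s))

variable {N : Fin n ⊕ Fin F.k ⊕ Fin F.l → Fin n ⊕ Fin F.k ⊕ Fin F.l → F.A c.dom}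

theorem euler_apply (a : F.A c.dom) :
    P.euler c N a =
      ∑ s, ∑ t, (c.wt t : ℝ) • (P.br c.dom a (c.coord s) * (N s t * c.coord t)) := by
  simp only [euler, LinearMap.sum_apply, LinearMap.smul_apply, LinearMap.comp_apply,
    LinearMap.mulRight_apply, LinearMap.flip_apply]

/-- The Euler vector field only differentiates along brackets with coordinates of weight at most
`1`: for other `s`, either `w_t = 0` or `N_{st}` has negative weight. -/
theorem euler_eq_zero
    (hN : ∀ s t, N s t ∈ F.comp c.dom (2 - c.wt s - c.wt t, c.par s + c.par t)) {a : F.A c.dom}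
    (ha : ∀ s, c.wt s ≤ 1 → P.br c.dom a (c.coord s) = 0) : P.euler c N a = 0 := by
  rw [euler_apply]
  refine Finset.sum_eq_zero fun s _ => Finset.sum_eq_zero fun t _ => ?_
  by_cases hs : c.wt s ≤ 1
  · rw [ha s hs, zero_mul, smul_zero]
  · rcases (wt_nonneg c t).eq_or_lt with ht | ht
    · rw [← ht, Int.cast_zero, zero_smul]
    · have h := hN s t
      rw [F.comp_neg _ _ _ (by omega), Submodule.mem_bot] at h
      rw [h, zero_mul, mul_zero, smul_zero]

theorem euler_mul
    (hN : ∀ s t, N s t ∈ F.comp c.dom (2 - c.wt s - c.wt t, c.par s + c.par t))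
    {w w' : ℤ} {p q : ZMod 2} {a b : F.A c.dom}
    (ha : a ∈ F.comp c.dom (w, p)) (hb : b ∈ F.comp c.dom (w', q)) :
    P.euler c N (a * b) = a * P.euler c N b + P.euler c N a * b := by
  simp only [euler_apply, Finset.mul_sum, Finset.sum_mul, ← Finset.sum_add_distrib]
  refine Finset.sum_congr rfl fun s _ => Finset.sum_congr rfl fun t _ => ?_
  have hNz := SetLike.mul_mem_graded (hN s t) (c.coord_mem t)
  have hsw := F.supercomm _ _ _ _ _ _ _ hb hNz
  rw [add_assoc, CharTwo.add_self_eq_zero, add_zero] at hsw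
  rw [P.br_mul_left ha hb (c.coord_mem s), add_mul, smul_mul_assoc, mul_assoc _ b, hsw,
    mul_smul_comm, superSign_smul_smul, mul_smul_comm, smul_mul_assoc, smul_add, mul_assoc,
    mul_assoc (P.br c.dom a _)]

theorem euler_coord (hBN : ∀ s u,
      ∑ t, P.br c.dom (c.coord s) (c.coord t) * N t u = if s = u then 1 else 0)
    (u : Fin n ⊕ Fin F.k ⊕ Fin F.l) : P.euler c N (c.coord u) = (c.wt u : ℝ) • c.coord u := by
  rw [euler_apply, Finset.sum_comm]
  simp only [← mul_assoc, ← Finset.smul_sum, ← Finset.sum_mul, hBN]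
  simp

theorem euler_of_weight_zero
    (hN : ∀ s t, N s t ∈ F.comp c.dom (2 - c.wt s - c.wt t, c.par s + c.par t))
    {p : ZMod 2} {f : F.A c.dom} (hf : f ∈ F.comp c.dom (0, p)) : P.euler c N f = 0 :=
  P.euler_eq_zero c hN fun s hs => P.br_eq_zero_of_weight_lt hf (c.coord_mem s) (by omega)

/-- The homogeneous functions on which the Euler vector field acts as multiplication by the
weight. -/
def eulerSubmonoid
    (hN : ∀ s t, N s t ∈ F.comp c.dom (2 - c.wt s - c.wt t, c.par s + c.par t)) :
    Submonoid (F.A c.dom) where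
  carrier := {a | ∃ w p, a ∈ F.comp c.dom (w, p) ∧ P.euler c N a = (w : ℝ) • a}
  one_mem' := by
    have h1 : (1 : F.A c.dom) ∈ F.comp c.dom (0, 0) := SetLike.one_mem_graded (F.comp c.dom)
    exact ⟨0, 0, h1, by rw [P.euler_of_weight_zero c hN h1, Int.cast_zero, zero_smul]⟩
  mul_mem' := by
    rintro a b ⟨w, p, ha, hEa⟩ ⟨w', q, hb, hEb⟩
    refine ⟨w + w', p + q, SetLike.mul_mem_graded ha hb, ?_⟩
    rw [P.euler_mul c hN ha hb, hEa, hEb, mul_smul_comm, smul_mul_assoc, Int.cast_add, add_smul,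
      add_comm]

/-- The Euler vector field acts on a function as multiplication by its weight. -/
theorem euler_of_mem
    (hN : ∀ s t, N s t ∈ F.comp c.dom (2 - c.wt s - c.wt t, c.par s + c.par t))
    (hBN : ∀ s u,
      ∑ t, P.br c.dom (c.coord s) (c.coord t) * N t u = if s = u then 1 else 0)
    {w : ℤ} {p : ZMod 2} {a : F.A c.dom} (ha : a ∈ F.comp c.dom (w, p)) :
    P.euler c N a = (w : ℝ) • a := by
  have key : ∀ (b : F.A c.dom) (d : ℤ × ZMod 2),
      DirectSum.decompose (F.comp c.dom) (P.euler c N b) d =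
        (d.1 : ℝ) • DirectSum.decompose (F.comp c.dom) b d := by
    intro b
    have hb := c.mem_span_of_submonoid (P.eulerSubmonoid c hN)
      (fun f => ⟨0, 0, c.pull_mem _ _ f,
        (P.euler_of_weight_zero c hN (c.pull_mem _ _ f)).trans (by rw [Int.cast_zero, zero_smul])⟩)
      (fun s => ⟨_, _, c.coord_mem _, P.euler_coord c hBN _⟩) b
    induction hb using Submodule.span_induction with
    | zero =>
      intro d
      rw [map_zero, DirectSum.decompose_zero, DirectSum.zero_apply, smul_zero]
    | add x y _ _ hx hy =>
      intro d
      rw [map_add, DirectSum.decompose_add, DirectSum.add_apply, hx, hy, DirectSum.decompose_add,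
        DirectSum.add_apply, smul_add]
    | smul t x _ hx =>
      intro d
      rw [map_smul, DirectSum.decompose_smul, DirectSum.smul_apply, hx, DirectSum.decompose_smul,
        DirectSum.smul_apply, smul_comm]
    | mem x hx =>
    intro d
    obtain ⟨w', q, hm, hE⟩ := hx
    rw [hE, DirectSum.decompose_smul]
    by_cases hd : (w', q) = d
    · subst hd
      rfl
    · have h0 : DirectSum.decompose (F.comp c.dom) _ d = 0 :=
        Subtype.ext (DirectSum.decompose_of_mem_ne _ hm hd)
      rw [DirectSum.smul_apply, h0, smul_zero, smul_zero]
  apply (DirectSum.decompose (F.comp c.dom)).injective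
  ext d
  rw [key, DirectSum.decompose_smul, DirectSum.smul_apply]
  by_cases hd : (w, p) = d
  · subst hd
    rfl
  · have h0 : DirectSum.decompose (F.comp c.dom) a d = 0 :=
      Subtype.ext (DirectSum.decompose_of_mem_ne _ ha hd)
    rw [h0, smul_zero, smul_zero]

/-- A function of non-zero weight which Poisson commutes with all coordinates of weight at most
`1` vanishes. -/
theorem Nondegenerate.eq_zero_of_br_coord_eq_zero {P : PoissonBracket F} (hP : P.Nondegenerate)
    {w : ℤ} {p : ZMod 2} {a : F.A c.dom} (ha : a ∈ F.comp c.dom (w, p)) (hw : w ≠ 0)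
    (h : ∀ s, c.wt s ≤ 1 → P.br c.dom a (c.coord s) = 0) : a = 0 := by
  obtain ⟨N, hN, hBN⟩ := hP.exists_homogeneous_inverse c
  have hE := P.euler_of_mem c hN hBN ha
  rw [P.euler_eq_zero c hN h] at hE
  exact (smul_eq_zero.1 hE.symm).resolve_left (Int.cast_ne_zero.2 hw)

/-- A base function `g` annihilating a coordinate `z_s` of weight `1` vanishes, since `g {z_s, z_t}`
is the bracket of `g z_s` with `z_t` for all `z_t` of weight at most `1`. -/
theorem Nondegenerate.eq_zero_of_mul_coord_eq_zero {P : PoissonBracket F} (hP : P.Nondegenerate)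
    {p : ZMod 2} {g : F.A c.dom} (hg : g ∈ F.comp c.dom (0, p))
    {s : Fin n ⊕ Fin F.k ⊕ Fin F.l} (hs : c.wt s = 1) (h : g * c.coord s = 0) : g = 0 := by
  obtain ⟨N, hN, hBN⟩ := hP.exists_homogeneous_inverse c
  have hss := hBN s s
  rw [if_pos rfl] at hss
  rw [← mul_one g, ← hss, Finset.mul_sum]
  refine Finset.sum_eq_zero fun t _ => ?_
  rw [← mul_assoc]
  by_cases ht : c.wt t ≤ 1
  · have hL := P.br_mul_left hg (c.coord_mem s) (c.coord_mem t)
    rw [h, map_zero, LinearMap.zero_apply,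
      P.br_eq_zero_of_weight_lt hg (c.coord_mem t) (by omega), zero_mul, smul_zero, add_zero] at hL
    rw [← hL, zero_mul]
  · have h0 := hN t s
    rw [F.comp_neg _ _ _ (by omega), Submodule.mem_bot] at h0
    rw [h0, mul_zero]

/-- Without coordinates of weight `1` there are no functions of weight `3`. -/
theorem Nondegenerate.eq_zero_of_weight_three {P : PoissonBracket F} (hP : P.Nondegenerate)
    {p : ZMod 2} {a : F.A c.dom} (ha : a ∈ F.comp c.dom (3, p)) (hc : ¬∃ s, c.wt s = 1) :
    a = 0 := by
  have h0 : ∀ s, c.wt s ≤ 1 → c.wt s = 0 := fun s hs => by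
    by_contra hne
    exact hc ⟨s, by have := wt_nonneg c s; omega⟩
  refine hP.eq_zero_of_br_coord_eq_zero c ha three_ne_zero fun s hs => ?_
  have hb := P.br_mem _ _ _ _ _ _ _ ha (c.coord_mem s)
  refine hP.eq_zero_of_br_coord_eq_zero c hb (by have := h0 s hs; omega) fun t ht => ?_
  exact P.br_eq_zero_of_weight_lt hb (c.coord_mem t) (by have := h0 s hs; have := h0 t ht; omega)

end PoissonBracket

/-! ### Locality and extension of local functions -/

namespace GradedFunctionSheaf

variable {M : Type u} [TopologicalSpace M] (F : GradedFunctionSheaf.{u, v} M)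

theorem eq_zero_of_iSup_eq {ι : Type u} (V : ι → Opens M) {U : Opens M} (hU : ⨆ i, V i = U)
    (hV : ∀ i, V i ≤ U) {d : ℤ × ZMod 2} {a : F.A U} (ha : a ∈ F.comp U d)
    (h : ∀ i, F.res (hV i) a = 0) : a = 0 := by
  subst hU
  obtain ⟨_, _, hu⟩ := F.glue V d (fun _ => 0) (fun _ => zero_mem _) (fun _ _ => by simp)
  exact (hu a ⟨ha, h⟩).trans (hu 0 ⟨zero_mem _, fun _ => map_zero _⟩).symm

theorem eq_zero_of_locally_eq_zero {U : Opens M} {d : ℤ × ZMod 2} {a : F.A U}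
    (ha : a ∈ F.comp U d)
    (h : ∀ m ∈ U, ∃ (V : Opens M) (hV : V ≤ U), m ∈ V ∧ F.res hV a = 0) : a = 0 := by
  choose V hV hmV hres using fun m : U => h m.1 m.2
  refine F.eq_zero_of_iSup_eq V (le_antisymm (iSup_le hV) fun m hm => ?_) hV ha hres
  exact Opens.mem_iSup.2 ⟨⟨m, hm⟩, hmV ⟨m, hm⟩⟩

/-- Extension by zero. -/
theorem exists_extension_of_res_eq_zero {U V : Opens M} (hUV : U ⊔ V = ⊤) {d : ℤ × ZMod 2}
    {a : F.A U} (ha : a ∈ F.comp U d) (h : F.res (inf_le_left : U ⊓ V ≤ U) a = 0) :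
    ∃ b ∈ F.comp ⊤ d, F.res le_top b = a := by
  have h' : F.res (inf_le_right : V ⊓ U ≤ U) a = 0 := by
    rw [← F.res_res inf_le_left (inf_comm V U).le, h, map_zero]
  let W : ULift.{u} Bool → Opens M := fun i => bif i.down then U else V
  let s : ∀ i, F.A (W i) := fun i => match i with
    | ⟨true⟩ => a
    | ⟨false⟩ => 0
  have hW : ⨆ i, W i = ⊤ := by
    rw [eq_top_iff, ← hUV]
    exact sup_le (le_iSup W ⟨true⟩) (le_iSup W ⟨false⟩)
  obtain ⟨b, ⟨hb, hres⟩, -⟩ := F.glue W d s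
    (by
      rintro ⟨_ | _⟩
      · exact zero_mem _
      · exact ha)
    (by
      rintro ⟨_ | _⟩ ⟨_ | _⟩
      · rfl
      · exact (map_zero _).trans h'.symm
      · exact h.trans (map_zero _).symm
      · rfl)
  have hb' := hres ⟨true⟩
  refine ⟨F.res hW.ge b, F.res_mem _ _ _ hb, ?_⟩
  rw [F.res_res]
  exact hb'

end GradedFunctionSheaf

namespace HomogeneousChart

variable {n : ℕ} {M : Type u} [TopologicalSpace M] [T2Space M]
  [ChartedSpace (EuclideanSpace ℝ (Fin n)) M] [IsManifold (𝓡 n) ∞ M]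
  {F : GradedFunctionSheaf.{u, v} M} {k l : ℕ} {wtEven : Fin k → ℤ} {wtOdd : Fin l → ℤ}

/-- Every function on the domain of the coordinates agrees near a given point with a global
function, obtained by multiplication with a bump function. -/
theorem exists_global_eq_near (c : HomogeneousChart (n := n) F wtEven wtOdd) {d : ℤ × ZMod 2}
    {a : F.A c.dom} (ha : a ∈ F.comp c.dom d) {m : M} (hm : m ∈ c.dom) :
    ∃ b ∈ F.comp ⊤ d, ∃ (V : Opens M) (hV : V ≤ c.dom), m ∈ V ∧ F.res le_top b = F.res hV a := by
  obtain ⟨χ, -, hχ⟩ := (SmoothBumpFunction.nhds_basis_tsupport (I := 𝓡 n) m).mem_iff.1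
    (c.dom.isOpen.mem_nhds hm)
  obtain ⟨t, ht1, ht, hmt⟩ := eventually_nhds_iff.1 χ.eventuallyEq_one
  let f : SmoothFun n c.dom :=
    ⟨fun x => χ x.1, χ.contMDiff.comp contMDiff_subtype_val⟩
  let Z : Opens M := ⟨(tsupport χ)ᶜ, (isClosed_tsupport χ).isOpen_compl⟩
  let V : Opens M := ⟨t, ht⟩ ⊓ c.dom
  have hV : V ≤ c.dom := inf_le_right
  have hfa : c.pull c.dom le_rfl f * a ∈ F.comp c.dom d := by
    have := SetLike.mul_mem_graded (c.pull_mem c.dom le_rfl f) ha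
    rwa [show ((0, 0) : ℤ × ZMod 2) + d = d from zero_add d] at this
  have hcover : c.dom ⊔ Z = ⊤ := by
    refine eq_top_iff.2 fun x _ => ?_
    by_cases hx : x ∈ tsupport χ
    · exact Or.inl (hχ hx)
    · exact Or.inr hx
  have hZ : F.res (inf_le_left : c.dom ⊓ Z ≤ c.dom) (c.pull c.dom le_rfl f * a) = 0 := by
    have hf : ContMDiffMap.restrictRingHom (𝓡 n) 𝓘(ℝ, ℝ) ℝ
        (inf_le_left : c.dom ⊓ Z ≤ c.dom) f = 0 := by
      ext x
      exact image_eq_zero_of_notMem_tsupport (f := χ) x.2.2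
    have h0 := c.res_pull c.dom (c.dom ⊓ Z) le_rfl inf_le_left f
    rw [map_mul, h0, hf, map_zero, zero_mul]
  obtain ⟨b, hb, hba⟩ := F.exists_extension_of_res_eq_zero hcover hfa hZ
  refine ⟨b, hb, V, hV, ⟨hmt, hm⟩, ?_⟩
  have hf : ContMDiffMap.restrictRingHom (𝓡 n) 𝓘(ℝ, ℝ) ℝ hV f = 1 := by
    ext x
    exact ht1 x.1 x.2.1
  have h1 := c.res_pull c.dom V le_rfl hV f
  rw [← F.res_res le_top hV, hba, map_mul, h1, hf, map_one, one_mul]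

end HomogeneousChart

namespace PoissonBracket

variable {n : ℕ} {M : Type u} [TopologicalSpace M] [T2Space M]
  [ChartedSpace (EuclideanSpace ℝ (Fin n)) M] [IsManifold (𝓡 n) ∞ M]
  {F : GradedSuperBundle2.{u, v} n M} (P : PoissonBracket F)
  (c : HomogeneousChart (n := n) F.toGradedFunctionSheaf F.wtEven F.wtOdd)

/-- A function Poisson commuting with the restrictions of all global functions of a given degree
Poisson commutes with all local functions of that degree. -/
theorem br_eq_zero_of_forall_global {w w' : ℤ} {p q : ZMod 2} {a z : F.A c.dom}
    (ha : a ∈ F.comp c.dom (w, p)) (hz : z ∈ F.comp c.dom (w', q))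
    (h : ∀ b ∈ F.comp ⊤ (w', q), P.br c.dom a (F.res le_top b) = 0) : P.br c.dom a z = 0 := by
  refine F.eq_zero_of_locally_eq_zero (P.br_mem _ _ _ _ _ _ _ ha hz) fun m hm => ?_
  obtain ⟨b, hb, V, hV, hmV, hbz⟩ := c.exists_global_eq_near hz hm
  refine ⟨V, hV, hmV, ?_⟩
  rw [P.res_br, ← hbz, ← F.res_res le_top hV, ← P.res_br, h b hb, map_zero]

/-- A function annihilating the restrictions of all global functions of a given degree annihilates
all local functions of that degree. -/
theorem mul_eq_zero_of_forall_global {d d' : ℤ × ZMod 2} {a z : F.A c.dom}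
    (ha : a ∈ F.comp c.dom d) (hz : z ∈ F.comp c.dom d')
    (h : ∀ b ∈ F.comp ⊤ d', a * F.res le_top b = 0) : a * z = 0 := by
  refine F.eq_zero_of_locally_eq_zero (SetLike.mul_mem_graded ha hz) fun m hm => ?_
  obtain ⟨b, hb, V, hV, hmV, hbz⟩ := c.exists_global_eq_near hz hm
  refine ⟨V, hV, hmV, ?_⟩
  rw [map_mul, ← hbz, ← F.res_res le_top hV, ← map_mul, h b hb, map_zero]

/-! ### Consequences of nondegeneracy for global functions -/

/-- The pairing of sections given by the bracket is nondegenerate. -/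
theorem Nondegenerate.section_eq_zero {P : PoissonBracket F} (hP : P.Nondegenerate)
    {p : ZMod 2} {σ : F.A ⊤} (hσ : σ ∈ F.comp ⊤ (1, p))
    (h : ∀ (q : ZMod 2), ∀ ψ ∈ F.comp ⊤ (1, q), P.br ⊤ σ ψ = 0) : σ = 0 := by
  refine F.eq_zero_of_locally_eq_zero hσ fun m _ => ?_
  obtain ⟨c, hm⟩ := F.exists_chart m
  have hσc := F.res_mem (le_top : c.dom ≤ ⊤) _ _ hσ
  refine ⟨c.dom, le_top, hm, hP.eq_zero_of_br_coord_eq_zero c hσc one_ne_zero fun s hs => ?_⟩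
  have hz := c.coord_mem s
  rcases hs.lt_or_eq with hs | hs
  · exact P.br_eq_zero_of_weight_lt hσc hz (by omega)
  · rw [hs] at hz
    refine P.br_eq_zero_of_forall_global c hσc hz fun b hb => ?_
    rw [← P.res_br, h _ b hb, map_zero]

/-- A function of weight `2` Poisson commuting with all sections vanishes on coordinate domains
having a coordinate of weight `1`. Its bracket with a base function `g` annihilates every section
`σ`, because it Poisson commutes with `g σ`. -/
theorem Nondegenerate.res_eq_zero_of_br_section_eq_zero {P : PoissonBracket F}
    (hP : P.Nondegenerate) {p : ZMod 2} {a : F.A ⊤} (ha : a ∈ F.comp ⊤ (2, p))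
    (h : ∀ (q : ZMod 2), ∀ σ ∈ F.comp ⊤ (1, q), P.br ⊤ a σ = 0)
    (hc : ∃ s, c.wt s = 1) : F.res (le_top : c.dom ≤ ⊤) a = 0 := by
  obtain ⟨s₁, hs₁⟩ := hc
  have hz₁ := c.coord_mem s₁
  rw [hs₁] at hz₁
  have hac := F.res_mem (le_top : c.dom ≤ ⊤) _ _ ha
  refine hP.eq_zero_of_br_coord_eq_zero c hac two_ne_zero fun s hs => ?_
  have hz := c.coord_mem s
  rcases hs.lt_or_eq with hs | hs
  · rw [show c.wt s = 0 by have := wt_nonneg c s; omega] at hz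
    refine P.br_eq_zero_of_forall_global c hac hz fun g hg => ?_
    have hag := P.br_mem _ _ _ _ _ _ _ ha hg
    have hagc := F.res_mem (le_top : c.dom ≤ ⊤) _ _ hag
    rw [← P.res_br]
    refine hP.eq_zero_of_mul_coord_eq_zero c hagc hs₁
      (mul_eq_zero_of_forall_global c hagc hz₁ fun σ hσ => ?_)
    have hgσ := SetLike.mul_mem_graded hg hσ
    have hL := P.leibniz _ _ _ _ _ _ _ σ ha hg
    rw [h _ _ hgσ, h _ _ hσ, mul_zero, smul_zero, add_zero] at hL
    rw [← map_mul, ← hL, map_zero]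
  · rw [hs] at hz
    refine P.br_eq_zero_of_forall_global c hac hz fun b hb => ?_
    rw [← P.res_br, h _ b hb, map_zero]

end PoissonBracket

namespace SymplecticNearlyLie2Algebroid

variable {n : ℕ} {M : Type u} [TopologicalSpace M] [ChartedSpace (EuclideanSpace ℝ (Fin n)) M]
  (L : SymplecticNearlyLie2Algebroid.{u, v} n M)

/-- If the defect of compatibility vanishes for a base function `f` and all sections, then
`{{Θ, Θ}, f} = 0`. On coordinate domains without coordinates of weight `1` this holds because `Θ`
itself vanishes there. -/
theorem pb_Θ_Θ_fun_eq_zero [T2Space M] [IsManifold (𝓡 n) ∞ M] {r : ZMod 2} {f : L.A ⊤}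
    (hf : f ∈ L.comp ⊤ (0, r))
    (h : ∀ (p q : ZMod 2) (σ : L.Sec p) (ψ : L.Sec q),
      L.pb (L.pb (L.pb (L.pb L.Θ L.Θ) f) σ) ψ = 0) :
    L.pb (L.pb L.Θ L.Θ) f = 0 := by
  have hP := L.nondegenerate
  have hG := L.pb_pb_Θ_Θ_mem hf
  refine L.eq_zero_of_locally_eq_zero hG fun m _ => ?_
  obtain ⟨c, hm⟩ := L.exists_chart m
  refine ⟨c.dom, le_top, hm, ?_⟩
  by_cases hc : ∃ s, c.wt s = 1
  · refine hP.res_eq_zero_of_br_section_eq_zero c hG (fun p σ hσ => ?_) hc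
    have hGσ := L.poisson.br_mem _ _ _ _ _ _ _ hG hσ
    exact hP.section_eq_zero hGσ fun q ψ hψ => h p q ⟨σ, hσ⟩ ⟨ψ, hψ⟩
  · have hΘ := hP.eq_zero_of_weight_three c (L.res_mem (le_top : c.dom ≤ ⊤) _ _ L.Θ_mem) hc
    unfold pb
    rw [L.poisson.res_br, L.poisson.res_br, hΘ, map_zero, map_zero, LinearMap.zero_apply]

/-- Linear maps out of `C^∞(M)` are determined by their values on parity-homogeneous functions. -/
theorem baseFun_hom_ext {V : Type*} [AddCommGroup V] [Module ℝ V] {X Y : L.baseFun →ₗ[ℝ] V}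
    (h : ∀ r f, L.IsHomogeneous r f → X f = Y f) : X = Y := by
  ext ⟨f, hf⟩
  induction (L.mem_baseFun.1 hf) using Submodule.iSup_induction' with
  | mem r x hx => exact h r ⟨x, _⟩ hx
  | zero => exact (map_zero X).trans (map_zero Y).symm
  | add x y hx hy hX hY =>
    have e := congrArg₂ (· + ·) (hX hx) (hY hy)
    simp only [← map_add] at e
    exact e

theorem anchorCompatible_iff [T2Space M] [IsManifold (𝓡 n) ∞ M] :
    L.AnchorCompatible ↔ ∀ f : L.baseFun, L.pb (L.pb L.Θ L.Θ) f = 0 := by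
  constructor
  · intro hL f
    suffices hX : L.poisson.br ⊤ (L.pb L.Θ L.Θ) ∘ₗ L.baseFun.val.toLinearMap = 0 from
      LinearMap.congr_fun hX f
    refine L.baseFun_hom_ext fun r f hf => L.pb_Θ_Θ_fun_eq_zero hf fun p q σ ψ => ?_
    have h := L.coe_lieBracket_anchor_sub_anchor_dorfman σ ψ f hf
    rw [hL p q σ ψ, sub_self, ZeroMemClass.coe_zero] at h
    refine (smul_eq_zero.1 h.symm).resolve_left (mul_ne_zero (by norm_num) ?_)
    exact left_ne_zero_of_mul_eq_one (superSign_mul_self _)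
  · intro h p q σ ψ
    refine L.baseFun_hom_ext fun r f hf => sub_eq_zero.1 (Subtype.ext ?_)
    rw [L.coe_lieBracket_anchor_sub_anchor_dorfman σ ψ f hf, h f]
    simp [pb]

end SymplecticNearlyLie2Algebroid

end PreCourant

theorem mainTheorem5 {n : ℕ} {M : Type u} [TopologicalSpace M] [T2Space M]
    [SecondCountableTopology M] [ChartedSpace (EuclideanSpace ℝ (Fin n)) M]
    [IsManifold (𝓡 n) ∞ M] (L : PreCourant.SymplecticNearlyLie2Algebroid.{u, v} n M) :
    (∀ (p q r : ZMod 2) (σ : L.Sec p) (ψ : L.Sec q) (f : L.baseFun), L.IsHomogeneous r f →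
      (((L.lieBracket (L.anchor σ) (L.anchor ψ) : Module.End ℝ L.baseFun) f -
          (L.anchor (L.dorfman σ ψ) : Module.End ℝ L.baseFun) f : L.baseFun) : L.A ⊤) =
        ((1 / 2 : ℝ) * PreCourant.superSign (r * (p + q) + q)) •
          L.pb (L.pb (L.pb (L.pb L.Θ L.Θ) f) σ) ψ) ∧
    (L.AnchorCompatible ↔ ∀ f : L.baseFun, L.pb (L.pb L.Θ L.Θ) f = 0) :=
  ⟨fun _ _ _ σ ψ f hf => L.coe_lieBracket_anchor_sub_anchor_dorfman σ ψ f hf,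
    L.anchorCompatible_iff⟩
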